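/- **Conventions.** $S, S'$ denote closed connected oriented smooth surfaces (the surfaces $S_g$). Let $F$ be $S^1$ or $\mathbb R$. A link in $S\times F$ is a smooth embedding $L=\bigsqcup_{i\in I}L_i$ of a disjoint union of circles into $S\times F$; a knot is a link with one component. Equivalence of links is generated by the following two operations and their inverses. (1) *Diffeomorphisms*: $L'$ is the image of $L$ under a diffeomorphism $\Phi:S\times F\to S'\times F$, up to renumbering and reparametrizing the components. For $F=S^1$, $\Phi$ has to preserve the projection to $S^1$ up to homotopy, i.e. $\mathrm{pr}_2\circ\Phi\simeq \mathrm{pr}_2$ (all diffeomorphisms isotopic to the identity and all products $\varphi\times\mathrm{id}$ have this property). (2) *Destabilization*: $C\subset S$ is a non-contractible smooth circle with $L\cap(C\times F)=\emptyset$; one cuts $S\times F$ along $C\times F$, pastes two copies of $D^2\times F$, and takes the component containing $L$ (the inverse operation is stabilization). The statement holds for each of the following choices. The ambient manifolds may be considered as oriented (then all diffeomorphisms, cuttings and pastings preserve orientation, and diffeomorphisms of $S\times\mathbb R$ preserve the upper and the lower end) or as unoriented (then $\Phi$ need not preserve orientation, $\mathrm{pr}_2\circ\Phi\simeq\overline{\mathrm{pr}_2}$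 is allowed too, and all diffeomorphisms $S\times\mathbb R\to S'\times\mathbb R$ are allowed); independently, the links may be considered as oriented (reparametrizations of the components preserve orientation) or as unoriented. Let $\Pi:\mathbb R\to S^1$, $\Pi(r)=e^{2\pi i r}$. The degree of a knot $K$ in $S\times S^1$ is the winding number of $\mathrm{pr}_2\circ K:S^1\to S^1$. A lifting of $K$ is a closed curve $\hat K:S^1\to S\times\mathbb R$ with $(\mathrm{id}_S\times\Pi)\circ\hat K=K$, and $K_s$, $s\in\mathbb Z$, is the translate of $\hat K$ by $s$ in the $\mathbb R$-direction. Cutting $S\times S^1$ along $S\times\{1\}$ gives $S\times[0,1]$, and projecting to $S$ gives the diagram of $K$; at a crossing (a double point of the projection) the over-arc is the one which is higher in $S\times[0,1]$. An arc of the diagram has label $a\in\mathbb Z$ if $\hat K$ has height in $[a,a+1)$ over it, and a crossing whose over-arc has label $b$ and whose under-arc has label $a$ has label $b-a$. **Corollary.** Let $K$ be a knot of degree $0$ in $S\times S^1$ and let $K'$ be a knot in $S'\times S^1$ equivalent to $K$ (in particular, $S=S'=S_g$ is allowed). Then $K'$ has degree $0$, $K$ and $K'$ have liftings, and for all choices of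 liftings $\bigsqcup_{s\in\mathbb Z}K_s$ and $\bigsqcup_{s\in\mathbb Z}K'_s$ are links with infinitely many components in $S\times\mathbb R$ and $S'\times\mathbb R$, which are equivalent. Moreover, for $n\in\mathbb Z$ the crossings of $\bigsqcup_s K_s$ in the layer $S\times[n,n+1)$ (projected to $S$) correspond to the crossings of the diagram of $K$: the point of $K_s$ at parameter $z$ passes over the point of $K_t$ at parameter $w$ in this layer if and only if $K$ has a crossing with over-arc through $z$ and under-arc through $w$, whose labels are $n-s$ and $n-t$ respectively. In particular a crossing with over-arc labelled $b$ and under-arc labelled $a$, i.e. with label $b-a$, corresponds in the layer $n=a+b$ to a crossing between the components $K_a$ (over) and $K_b$ (under). -/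

import Mathlib

open scoped Manifold ContDiff Topology
open Filter Set

namespace SurfaceLink

/-- A closed oriented smooth surface, not necessarily connected: a compact Hausdorff smooth
2-manifold without boundary whose atlas has orientation preserving transition maps. The connected
ones are, up to orientation preserving diffeomorphism, the surfaces `S_g`. -/
structure ClosedSurface where
  carrier : Type
  [top : TopologicalSpace carrier]
  [charted : ChartedSpace (EuclideanSpace ℝ (Fin 2)) carrier]
  [smooth : IsManifold (𝓡 2) ∞ carrier]
  [hausdorff : T2Space carrier]
  [compact : CompactSpace carrier]
  oriented : ∀ e ∈ atlas (EuclideanSpace ℝ (Fin 2)) carrier,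
    ∀ e' ∈ atlas (EuclideanSpace ℝ (Fin 2)) carrier,
      ∀ y ∈ (e.symm.trans e').source,
        0 < (fderiv ℝ (fun u => e' (e.symm u)) y).det

instance : CoeSort ClosedSurface Type := ⟨ClosedSurface.carrier⟩

attribute [instance] ClosedSurface.top ClosedSurface.charted ClosedSurface.smooth
  ClosedSurface.hausdorff ClosedSurface.compact

/-- The covering `Π : ℝ → S¹`, `Π r = exp (2 π r i)`. -/
noncomputable def cov (r : ℝ) : Circle := Circle.exp (2 * Real.pi * r)

/-- The covering `Id × Π : S × ℝ → S × S¹`. -/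
noncomputable def surfaceCov (S : ClosedSurface) (p : S × ℝ) : S × Circle := (p.1, cov p.2)

section Links

variable {E H : Type} [NormedAddCommGroup E] [NormedSpace ℝ E] [TopologicalSpace H]
  (J : ModelWithCorners ℝ E H)
  (F : Type) [TopologicalSpace F] [ChartedSpace H F]

/-- A smooth embedding of the disjoint union of circles indexed by `ι` into `S × F`. -/
structure IsLink (S : ClosedSurface) {ι : Type} (L : ι → Circle → S × F) : Prop where
  smooth : ∀ i, ContMDiff (𝓡 1) ((𝓡 2).prod J) ∞ (L i)
  immersive : ∀ i z, Function.Injective (mfderiv (𝓡 1) ((𝓡 2).prod J) (L i) z)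
  embedding : Topology.IsEmbedding (fun p : Σ _ : ι, Circle => L p.1 p.2)

/-- A link with components indexed by `ι` in `S × F`, where `S` is some closed connected oriented
surface. It is used for `F = S¹` and for `F = ℝ`. -/
structure Link (ι : Type) where
  surface : ClosedSurface
  connected : ConnectedSpace surface
  toFun : ι → Circle → surface × F
  isLink : IsLink J F surface toFun

end Links

/-- `r` is an orientation preserving diffeomorphism of the circle: it lifts to a continuous
increasing function on the line. -/
def PreservesCircleOrientation (r : Circle ≃ₘ⟮𝓡 1, 𝓡 1⟯ Circle) : Prop :=
  ∃ f : ℝ → ℝ, Continuous f ∧ StrictMono f ∧ ∀ t, r (cov t) = cov (f t)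

/-- A diffeomorphism `S × S¹ → S' × S¹` preserves orientation: its differential, written in
oriented charts of the surfaces and in the coordinate `t ↦ Π t` of `S¹`, has positive
determinant. -/
def PreservesOrientationCircle {S S' : ClosedSurface}
    (Φ : (S × Circle) ≃ₘ⟮(𝓡 2).prod (𝓡 1), (𝓡 2).prod (𝓡 1)⟯ (S' × Circle)) : Prop :=
  ∀ (x : S) (t : ℝ), ∃ (t' : ℝ)
    (A : (EuclideanSpace ℝ (Fin 2) × ℝ) →L[ℝ] (EuclideanSpace ℝ (Fin 2) × ℝ)),
    cov t' = (Φ (x, cov t)).2 ∧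
    (∀ v : EuclideanSpace ℝ (Fin 2) × ℝ,
      mfderiv ((𝓡 2).prod 𝓘(ℝ, ℝ)) ((𝓡 2).prod (𝓡 1)) (fun p => Φ (surfaceCov S p)) (x, t) v =
        mfderiv ((𝓡 2).prod 𝓘(ℝ, ℝ)) ((𝓡 2).prod (𝓡 1)) (surfaceCov S')
          ((Φ (x, cov t)).1, t') (A v)) ∧
    0 < A.det

/-- A diffeomorphism `S × ℝ → S' × ℝ` preserves orientation. -/
def PreservesOrientationReal {S S' : ClosedSurface}
    (Φ : (S × ℝ) ≃ₘ⟮(𝓡 2).prod 𝓘(ℝ, ℝ), (𝓡 2).prod 𝓘(ℝ, ℝ)⟯ (S' × ℝ)) : Prop :=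
  ∀ p : S × ℝ, 0 < (mfderiv ((𝓡 2).prod 𝓘(ℝ, ℝ)) ((𝓡 2).prod 𝓘(ℝ, ℝ)) Φ p :
    (EuclideanSpace ℝ (Fin 2) × ℝ) →L[ℝ] (EuclideanSpace ℝ (Fin 2) × ℝ)).det

/-- The map `f` of surfaces preserves orientation at `x`. -/
def PreservesOrientationAt {S S' : ClosedSurface} (f : S → S') (x : S) : Prop :=
  0 < (mfderiv (𝓡 2) (𝓡 2) f x :
    EuclideanSpace ℝ (Fin 2) →L[ℝ] EuclideanSpace ℝ (Fin 2)).det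

/-- The diffeomorphisms allowed between the manifolds `S × S¹`. They have to respect the projection
to `S¹` up to homotopy. If the ambient manifolds are considered as oriented (`ambient = true`)
they preserve the orientation of the manifold and of `S¹`; otherwise the orientation of the
manifold is ignored and the projection to `S¹` may be composed with a reflection. -/
def AllowedCircle (ambient : Bool) (S S' : ClosedSurface)
    (Φ : (S × Circle) ≃ₘ⟮(𝓡 2).prod (𝓡 1), (𝓡 2).prod (𝓡 1)⟯ (S' × Circle)) : Prop :=
  let q : C(S × Circle, Circle) := ⟨fun p => (Φ p).2, continuous_snd.comp Φ.continuous⟩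
  let q₀ : C(S × Circle, Circle) := ⟨fun p => p.2, continuous_snd⟩
  let q₁ : C(S × Circle, Circle) := ⟨fun p => p.2⁻¹, continuous_snd.inv⟩
  if ambient then q.Homotopic q₀ ∧ PreservesOrientationCircle Φ
  else q.Homotopic q₀ ∨ q.Homotopic q₁

/-- The diffeomorphisms allowed between the manifolds `S × ℝ`: all of them if orientations of the
ambient manifolds are ignored; otherwise those which preserve the orientation, the upper end and
the lower end. -/
def AllowedReal (ambient : Bool) (S S' : ClosedSurface)
    (Φ : (S × ℝ) ≃ₘ⟮(𝓡 2).prod 𝓘(ℝ, ℝ), (𝓡 2).prod 𝓘(ℝ, ℝ)⟯ (S' × ℝ)) : Prop :=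
  ambient = true → PreservesOrientationReal Φ ∧
    Tendsto (fun p => (Φ p).2) (comap Prod.snd atTop) atTop ∧
    Tendsto (fun p => (Φ p).2) (comap Prod.snd atBot) atBot

/-- Cutting a closed surface `S` along a non-contractible smooth circle `C` and pasting two disks
gives a closed surface `T`, of which the connected surface `S'` is a component.

The circle is `C = collar (S¹ × 0)`, where `collar` is a tubular neighbourhood. The map `keep`
identifies `S \ C` with the complement in `T` of two disjoint closed disks `disk₁ D` and
`disk₂ D`, where `D` is the unit disk of `ℂ`; the two sides `t > 0` and `t < 0` of the
collar become the outer collars of the two disks. -/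
structure CutAndCap (S S' : ClosedSurface) where
  collar : Circle × ℝ → S
  collar_inj : Function.Injective collar
  collar_diffeo : IsLocalDiffeomorph ((𝓡 1).prod 𝓘(ℝ, ℝ)) (𝓡 2) ∞ collar
  essential : ¬ ContinuousMap.Nullhomotopic (⟨fun z => collar (z, 0),
    collar_diffeo.contMDiff.continuous.comp (by fun_prop)⟩ : C(Circle, S))
  T : ClosedSurface
  disk₁ : ℂ → T
  disk₂ : ℂ → T
  disk₁_inj : Function.Injective disk₁
  disk₂_inj : Function.Injective disk₂
  disk₁_diffeo : IsLocalDiffeomorph 𝓘(ℝ, ℂ) (𝓡 2) ∞ disk₁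
  disk₂_diffeo : IsLocalDiffeomorph 𝓘(ℝ, ℂ) (𝓡 2) ∞ disk₂
  disks_disjoint : Disjoint (range disk₁) (range disk₂)
  keep : S → T
  keep_inj : InjOn keep (collar '' (univ ×ˢ {0}))ᶜ
  keep_diffeo : IsLocalDiffeomorphOn (𝓡 2) (𝓡 2) ∞ keep (collar '' (univ ×ˢ {0}))ᶜ
  keep_image : keep '' (collar '' (univ ×ˢ {0}))ᶜ =
    (disk₁ '' Metric.closedBall 0 1 ∪ disk₂ '' Metric.closedBall 0 1)ᶜ
  glue₁ : ∀ (z : Circle) (t : ℝ), 0 < t → keep (collar (z, t)) = disk₁ ((1 + t : ℝ) * (z : ℂ))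
  glue₂ : ∀ (z : Circle) (t : ℝ), 0 < t → keep (collar (z, -t)) = disk₂ ((1 + t : ℝ) * (z : ℂ))
  component : S' → T
  component_inj : Function.Injective component
  component_diffeo : IsLocalDiffeomorph (𝓡 2) (𝓡 2) ∞ component

/-- The circle along which the surface is cut. -/
def CutAndCap.circle {S S' : ClosedSurface} (D : CutAndCap S S') : Set S :=
  D.collar '' (univ ×ˢ {0})

/-- The orientations of the two surfaces agree. -/
def CutAndCap.PreservesOrientation {S S' : ClosedSurface} (D : CutAndCap S S') : Prop :=
  (∀ x ∉ D.circle, PreservesOrientationAt D.keep x) ∧ ∀ x, PreservesOrientationAt D.component x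

section Equivalence

variable {E H : Type} [NormedAddCommGroup E] [NormedSpace ℝ E] [TopologicalSpace H]
  {J : ModelWithCorners ℝ E H}
  {F : Type} [TopologicalSpace F] [ChartedSpace H F] {ι : Type}

/-- `L'` is the image of `L` under an allowed diffeomorphism of the ambient manifolds, up to
renumbering and reparametrizing the components; reparametrizations preserve orientation if the
links are considered as oriented (`oriented = true`). -/
def DiffeoStep
    (allowed : ∀ S S' : ClosedSurface, ((S × F) ≃ₘ⟮(𝓡 2).prod J, (𝓡 2).prod J⟯ (S' × F)) → Prop)
    (oriented : Bool) (L L' : Link J F ι) : Prop :=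
  ∃ Φ : (L.surface × F) ≃ₘ⟮(𝓡 2).prod J, (𝓡 2).prod J⟯ (L'.surface × F),
    allowed L.surface L'.surface Φ ∧
    ∃ (σ : Equiv.Perm ι) (r : ι → Circle ≃ₘ⟮𝓡 1, 𝓡 1⟯ Circle),
      (oriented = true → ∀ i, PreservesCircleOrientation (r i)) ∧
      ∀ i z, Φ (L.toFun i z) = L'.toFun (σ i) (r i z)

/-- Destabilization: `L` is disjoint from `C × F` for a non-contractible circle `C` on the surface,
`S × F` is cut along `C × F`, two copies of `disk × F` are pasted, and `L'` is `L` in the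
component which contains it. -/
def DestabilizationStep (ambient : Bool) (L L' : Link J F ι) : Prop :=
  ∃ D : CutAndCap L.surface L'.surface,
    (ambient = true → D.PreservesOrientation) ∧
    (∀ i z, (L.toFun i z).1 ∉ D.circle) ∧
    ∀ i z, D.component (L'.toFun i z).1 = D.keep (L.toFun i z).1 ∧
      (L'.toFun i z).2 = (L.toFun i z).2

/-- Equivalence of links: generated by allowed diffeomorphisms and destabilizations (and their
inverses, the stabilizations). -/
def Equivalent
    (allowed : ∀ S S' : ClosedSurface, ((S × F) ≃ₘ⟮(𝓡 2).prod J, (𝓡 2).prod J⟯ (S' × F)) → Prop)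
    (ambient oriented : Bool) : Link J F ι → Link J F ι → Prop :=
  Relation.EqvGen fun L L' => DiffeoStep allowed oriented L L' ∨ DestabilizationStep ambient L L'

end Equivalence

/-- A knot in `S × S¹`: a link with one component. -/
abbrev Knot := Link (𝓡 1) Circle Unit

/-- The parametrized circle in `S × S¹` underlying a knot. -/
def Knot.curve (K : Knot) : Circle → K.surface × Circle := K.toFun ()

/-- Equivalence of links in the manifolds `S × S¹`. -/
def EquivalentInCircleBundle (ambient oriented : Bool) {ι : Type} :
    Link (𝓡 1) Circle ι → Link (𝓡 1) Circle ι → Prop :=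
  Equivalent (AllowedCircle ambient) ambient oriented

/-- Equivalence of links in the manifolds `S × ℝ`. -/
def EquivalentInLineBundle (ambient oriented : Bool) {ι : Type} :
    Link 𝓘(ℝ, ℝ) ℝ ι → Link 𝓘(ℝ, ℝ) ℝ ι → Prop :=
  Equivalent (AllowedReal ambient) ambient oriented

/-- The knot `K` has degree `d`: it turns `d` times around `S¹`. -/
def HasDegree (K : Knot) (d : ℤ) : Prop :=
  ∃ f : ℝ → ℝ, Continuous f ∧ (∀ t, cov (f t) = (K.curve (cov t)).2) ∧
    ∀ t, f (t + 1) = f t + d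

/-- `k` is a lifting of the knot `K` along the covering `Id × Π`. -/
def IsLifting (K : Knot) (k : Circle → K.surface × ℝ) : Prop :=
  Continuous k ∧ ∀ z, surfaceCov K.surface (k z) = K.curve z

/-- The liftings `K_s`, `s ∈ ℤ`, of a knot: the translates of one lifting `k`. -/
def liftings {S : ClosedSurface} (k : Circle → S × ℝ) (s : ℤ) (z : Circle) : S × ℝ :=
  ((k z).1, (k z).2 + s)

/-- The height in `[0, 1)` of a point of `S¹` after cutting `S¹` at the point `1`. -/
noncomputable def cutHeight (ζ : Circle) : ℝ := Int.fract (Complex.arg (ζ : ℂ) / (2 * Real.pi))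

/-- The diagram of `K` on the surface (obtained after cutting `S × S¹` along `S × {1}`) has a
crossing whose over-arc passes through the parameter `z` and whose under-arc passes through `w`. -/
def IsCrossing (K : Knot) (z w : Circle) : Prop :=
  (K.curve z).1 = (K.curve w).1 ∧ cutHeight (K.curve w).2 < cutHeight (K.curve z).2

/-- The label of the arc of the diagram through the parameter `z`: the integer `a` such that the
lifting has height in `[a, a + 1)` there. -/
noncomputable def arcLabel {S : ClosedSurface} (k : Circle → S × ℝ) (z : Circle) : ℤ := ⌊(k z).2⌋

/-- The label `b - a` of a crossing with over-arc labelled `b` and under-arc labelled `a`. -/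
noncomputable def crossingLabel {S : ClosedSurface} (k : Circle → S × ℝ) (z w : Circle) : ℤ :=
  arcLabel k z - arcLabel k w

/-- The diagram on the surface of the part of the link `L` in the layer `S × [n, n + 1)` has a
crossing at which the component `L s` at parameter `z` passes over the component `L t` at
parameter `w`. -/
def IsLayerCrossing {S : ClosedSurface} (L : ℤ → Circle → S × ℝ) (n s : ℤ) (z : Circle)
    (t : ℤ) (w : Circle) : Prop :=
  (L s z).1 = (L t w).1 ∧ (L t w).2 < (L s z).2 ∧
    (L s z).2 ∈ Ico (n : ℝ) (n + 1) ∧ (L t w).2 ∈ Ico (n : ℝ) (n + 1)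

end SurfaceLink

open SurfaceLink

/-!
Everything is lifted along the covering `Id × Π : S × ℝ → S × S¹`.

A knot has degree `0` exactly if its projection to `S¹` has a logarithm, i.e. factors through `Π`
(`hasDegree_zero_iff`); a logarithm is the height function of a lifting. The translates of a lifting
are the components of the preimage of the knot, so they form a link (`isLink_liftings`): they are
disjoint, embedded and immersed because the knot is, and by compactness they are locally finite.
Since the circle is connected, two liftings differ by an integer, so the link does not depend on the
lifting up to renumbering (`equivalent_liftLink_self`).

It remains to lift the generators of the equivalence relation.

* Let `Φ : S × S¹ → S' × S¹` be an allowed diffeomorphism. The homotopy between `pr₂ ∘ Φ` and `pr₂`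
  or its inverse lifts to the line, which gives a continuous real function `θ` on `S × S¹` with
  `pr₂ (Φ (x, ζ)) = ζ ^ ε * Π (θ (x, ζ))`, where `ε = ±1` (`exists_cov_mul_of_homotopic`). So
  `(x, t) ↦ (pr₁ (Φ (x, Π t)), ε t + θ (x, Π t))` covers `Φ`. The inverse of `Φ` has the logarithm
  `-ε θ ∘ Φ⁻¹`, and the corresponding map is the inverse of this one (`liftDiffeo`). The lift
  preserves orientation if `Φ` does because the coverings are local diffeomorphisms, and for `ε = 1`
  it preserves the ends because `θ` is bounded. It intertwines the translations by `s` and `ε s`, so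
  it maps the liftings of a knot to the liftings of its image and renumbers them by an affine
  permutation of `ℤ` (`equivalent_liftLink_of_diffeo`).
* A destabilization changes only the surface and leaves heights alone, so the same surgery on the
  surface applies to the liftings (`equivalent_liftLink_of_destabilizationStep`).

The correspondence of the crossings holds because the height in `[0, 1)` of a point of the cut knot
is the fractional part of the height of the lifting, and the label is its integral part.
-/

namespace SurfaceLink

/-! ### The covering of the circle by the line -/

theorem cov_add (x y : ℝ) : cov (x + y) = cov x * cov y := by
  simp only [cov, mul_add, Circle.exp_add]

theorem cov_zero : cov 0 = 1 := by simp [cov]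

theorem cov_neg (x : ℝ) : cov (-x) = (cov x)⁻¹ := by
  simp only [cov, mul_neg, Circle.exp_neg]

theorem cov_intCast_mul (n : ℤ) (x : ℝ) : cov (n * x) = cov x ^ n := by
  rw [cov, cov, ← Circle.exp_zsmul]
  congr 1
  simp only [zsmul_eq_mul]
  ring

theorem cov_eq_cov {x y : ℝ} : cov x = cov y ↔ ∃ m : ℤ, x = y + m := by
  rw [cov, cov, Circle.exp_eq_exp]
  refine exists_congr fun m => ?_
  have h : (2 * Real.pi) ≠ 0 := Real.two_pi_pos.ne'
  rw [show 2 * Real.pi * y + m * (2 * Real.pi) = 2 * Real.pi * (y + m) by ring, mul_right_inj' h]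

theorem cov_add_int (x : ℝ) (m : ℤ) : cov (x + m) = cov x :=
  cov_eq_cov.2 ⟨m, rfl⟩

/-- The argument of a point of the circle, measured in full turns. -/
noncomputable def turn (ζ : Circle) : ℝ := Complex.arg (ζ : ℂ) / (2 * Real.pi)

theorem cov_turn (ζ : Circle) : cov (turn ζ) = ζ := by
  rw [cov, turn, mul_div_cancel₀ _ Real.two_pi_pos.ne', Circle.exp_arg]

theorem turn_cov {x : ℝ} (h₁ : -(1 / 2) < x) (h₂ : x < 1 / 2) : turn (cov x) = x := by
  have hpi := Real.pi_pos
  rw [turn, cov, Circle.arg_exp (by nlinarith) (by nlinarith), mul_div_cancel_left₀ _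
    Real.two_pi_pos.ne']

theorem contMDiff_cov : ContMDiff 𝓘(ℝ, ℝ) (𝓡 1) ∞ cov :=
  contMDiff_circleExp.comp (contDiff_const.mul contDiff_id).contMDiff

theorem continuous_cov : Continuous cov := contMDiff_cov.continuous

/-- Near `1` the argument is the imaginary part of the complex logarithm. -/
theorem contMDiffAt_turn : ContMDiffAt (𝓡 1) 𝓘(ℝ, ℝ) ∞ turn 1 := by
  have := finrank_real_complex_fact'
  have h₁ : ContMDiff (𝓡 1) 𝓘(ℝ, ℂ) ∞ (fun ζ : Circle => (ζ : ℂ)) :=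
    contMDiff_coe_sphere (E := ℂ) (n := 1)
  have h₂ : ContDiffAt ℝ ∞ (fun z : ℂ => (Complex.log z).im / (2 * Real.pi))
      ((1 : Circle) : ℂ) := by
    have h := (Complex.contDiffAt_log (n := ∞) (x := ((1 : Circle) : ℂ))
      (by simp [Complex.one_mem_slitPlane])).restrict_scalars ℝ
    exact (Complex.imCLM.contDiff.contDiffAt.comp _ h).div_const _
  have h₃ := ContMDiffAt.comp (1 : Circle) h₂.contMDiffAt h₁.contMDiffAt
  refine h₃.congr_of_eventuallyEq (Eventually.of_forall fun ζ => ?_)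
  simp only [turn, Complex.log_im]
  rfl

section Smoothness

variable {E H M : Type*} [NormedAddCommGroup E] [NormedSpace ℝ E] [TopologicalSpace H]
  {I : ModelWithCorners ℝ E H} [TopologicalSpace M] [ChartedSpace H M]

/-- A continuous lift of a smooth function to the circle is smooth. -/
theorem contMDiff_of_cov_comp {f : M → ℝ} (hf : Continuous f)
    (h : ContMDiff I (𝓡 1) ∞ fun x => cov (f x)) : ContMDiff I 𝓘(ℝ, ℝ) ∞ f := by
  have : LieGroup (𝓡 1) ∞ Circle := LieGroup.of_le (n := ω) le_top
  intro x₀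
  have h₁ : ContMDiffAt I (𝓡 1) ∞ (fun x => cov (f x) * (cov (f x₀))⁻¹) x₀ :=
    (h x₀).mul contMDiffAt_const
  have h₂ : ContMDiffAt I 𝓘(ℝ, ℝ) ∞ (fun x => turn (cov (f x) * (cov (f x₀))⁻¹)) x₀ := by
    refine ContMDiffAt.comp x₀ (g := turn) ?_ h₁
    rw [mul_inv_cancel]
    exact contMDiffAt_turn
  have h₃ : ContMDiffAt I 𝓘(ℝ, ℝ) ∞
      (fun x => turn (cov (f x) * (cov (f x₀))⁻¹) + f x₀) x₀ := h₂.add contMDiffAt_const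
  refine h₃.congr_of_eventuallyEq ?_
  have h₄ : ∀ᶠ x in 𝓝 x₀, f x - f x₀ ∈ Ioo (-(1 / 2) : ℝ) (1 / 2) := by
    refine (hf.sub continuous_const).continuousAt.eventually_mem (Ioo_mem_nhds ?_ ?_) <;> norm_num
  filter_upwards [h₄] with x hx
  rw [← cov_neg, ← cov_add, ← sub_eq_add_neg, turn_cov hx.1 hx.2, sub_add_cancel]

end Smoothness

/-- The homotopy lifting property, for maps to the group `S¹`: homotopic maps differ by a factor
which has a logarithm. -/
theorem exists_cov_mul_of_homotopic {X : Type*} [TopologicalSpace X] {q q₀ : C(X, Circle)}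
    (h : q.Homotopic q₀) : ∃ θ : C(X, ℝ), ∀ x, q x = q₀ x * cov (θ x) := by
  obtain ⟨G⟩ := h.symm
  let G' : C(unitInterval × X, Circle) := ⟨fun p => G p * (q₀ p.2)⁻¹, by fun_prop⟩
  have h₀ : ∀ a, G' (0, a) = Circle.exp ((0 : C(X, ℝ)) a) := by simp [G']
  let Γ := Circle.isCoveringMap_exp.liftHomotopy G' 0 h₀
  have hΓ : ∀ p, Circle.exp (Γ p) = G' p :=
    fun p => congrFun (Circle.isCoveringMap_exp.liftHomotopy_lifts G' 0 h₀) p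
  refine ⟨⟨fun x => Γ (1, x) / (2 * Real.pi), by fun_prop⟩, fun x => ?_⟩
  change q x = q₀ x * Circle.exp (2 * Real.pi * (Γ (1, x) / (2 * Real.pi)))
  rw [mul_div_cancel₀ _ Real.two_pi_pos.ne', hΓ]
  simp [G']

theorem isQuotientMap_cov : Topology.IsQuotientMap cov := by
  refine Topology.IsQuotientMap.comp (g := Circle.exp) (f := fun x : ℝ => 2 * Real.pi * x) ?_ ?_
  · exact Circle.isCoveringMap_exp.isQuotientMap Circle.exp_surjective
  · exact (Homeomorph.mulLeft₀ (2 * Real.pi) Real.two_pi_pos.ne').isQuotientMap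

/-- Two real functions on a connected space with the same image in the circle differ by an
integer. -/
theorem exists_int_of_cov_comp_eq {X : Type*} [TopologicalSpace X] [PreconnectedSpace X]
    [Nonempty X] {f g : X → ℝ} (hf : Continuous f) (hg : Continuous g)
    (h : ∀ x, cov (f x) = cov (g x)) : ∃ m : ℤ, ∀ x, f x = g x + m := by
  obtain ⟨x₀⟩ := ‹Nonempty X›
  obtain ⟨m, hm⟩ := cov_eq_cov.1 (h x₀)
  refine ⟨m, fun x => ?_⟩
  have key := Circle.isCoveringMap_exp.eq_of_comp_eq (g₁ := fun x => 2 * Real.pi * f x)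
    (g₂ := fun x => 2 * Real.pi * (g x + m)) (by fun_prop) (by fun_prop)
    (funext fun y => (h y).trans (cov_add_int (g y) m).symm) x₀ (by simp only [hm])
  exact mul_left_cancel₀ Real.two_pi_pos.ne' (congrFun key x)

theorem cutHeight_cov (x : ℝ) : cutHeight (cov x) = Int.fract x := by
  obtain ⟨m, hm⟩ := cov_eq_cov.1 (cov_turn (cov x))
  rw [cutHeight, ← turn, hm, Int.fract_add_intCast]

/-! ### The covering of the thickened surface -/

section SurfaceCov

variable (S : ClosedSurface)

theorem contMDiff_surfaceCov :
    ContMDiff ((𝓡 2).prod 𝓘(ℝ, ℝ)) ((𝓡 2).prod (𝓡 1)) ∞ (surfaceCov S) :=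
  contMDiff_fst.prodMk (contMDiff_cov.comp contMDiff_snd)

theorem surfaceCov_add_int (x : S) (t : ℝ) (m : ℤ) :
    surfaceCov S (x, t + m) = surfaceCov S (x, t) := by
  simp only [surfaceCov, cov_add_int]

variable {S}

theorem surfaceCov_eq {p q : S × ℝ} :
    surfaceCov S p = surfaceCov S q ↔ p.1 = q.1 ∧ ∃ m : ℤ, p.2 = q.2 + m := by
  simp only [surfaceCov, Prod.mk.injEq, cov_eq_cov]

theorem contMDiff_of_surfaceCov_comp {E H M : Type*} [NormedAddCommGroup E] [NormedSpace ℝ E]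
    [TopologicalSpace H] {I : ModelWithCorners ℝ E H} [TopologicalSpace M] [ChartedSpace H M]
    {f : M → S × ℝ} (hf : Continuous f)
    (h : ContMDiff I ((𝓡 2).prod (𝓡 1)) ∞ fun x => surfaceCov S (f x)) :
    ContMDiff I ((𝓡 2).prod 𝓘(ℝ, ℝ)) ∞ f :=
  (contMDiff_fst.comp h).prodMk
    (contMDiff_of_cov_comp (continuous_snd.comp hf) (contMDiff_snd.comp h))

theorem mdifferentiableAt_surfaceCov (p : S × ℝ) :
    MDifferentiableAt ((𝓡 2).prod 𝓘(ℝ, ℝ)) ((𝓡 2).prod (𝓡 1)) (surfaceCov S) p :=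
  (contMDiff_surfaceCov S).mdifferentiableAt (by simp)

/-- The covering is an immersion, because it has a local smooth left inverse. -/
theorem mfderiv_surfaceCov_injective (p : S × ℝ) : Function.Injective
    (mfderiv ((𝓡 2).prod 𝓘(ℝ, ℝ)) ((𝓡 2).prod (𝓡 1)) (surfaceCov S) p) := by
  have : LieGroup (𝓡 1) ∞ Circle := LieGroup.of_le (n := ω) le_top
  let l : S × Circle → S × ℝ := fun q => (q.1, turn (q.2 * (cov p.2)⁻¹) + p.2)
  have hl : ContMDiffAt ((𝓡 2).prod (𝓡 1)) ((𝓡 2).prod 𝓘(ℝ, ℝ)) ∞ l (surfaceCov S p) := by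
    refine contMDiffAt_fst.prodMk (ContMDiffAt.add ?_ contMDiffAt_const)
    refine ContMDiffAt.comp (surfaceCov S p) (g := turn)
      (f := fun q : S × Circle => q.2 * (cov p.2)⁻¹) ?_ (contMDiffAt_snd.mul contMDiffAt_const)
    simp only [surfaceCov, mul_inv_cancel]
    exact contMDiffAt_turn
  have hid : (fun q => l (surfaceCov S q)) =ᶠ[𝓝 p] id := by
    have h₄ : ∀ᶠ q : S × ℝ in 𝓝 p, q.2 - p.2 ∈ Ioo (-(1 / 2) : ℝ) (1 / 2) := by
      refine (continuous_snd.sub continuous_const).continuousAt.eventually_mem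
        (Ioo_mem_nhds ?_ ?_) <;> norm_num
    filter_upwards [h₄] with q hq
    simp only [l, surfaceCov, id]
    rw [← cov_neg, ← cov_add, ← sub_eq_add_neg, turn_cov hq.1 hq.2, sub_add_cancel]
  have hc := mfderiv_comp p (hl.mdifferentiableAt (by simp)) (mdifferentiableAt_surfaceCov p)
  have hc' := (hid.mfderiv_eq (I := (𝓡 2).prod 𝓘(ℝ, ℝ)) (I' := (𝓡 2).prod 𝓘(ℝ, ℝ))).symm.trans hc
  rw [mfderiv_id] at hc'
  refine Function.LeftInverse.injective
    (g := mfderiv ((𝓡 2).prod (𝓡 1)) ((𝓡 2).prod 𝓘(ℝ, ℝ)) l (surfaceCov S p)) fun v => ?_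
  exact (DFunLike.congr_fun hc' v).symm

end SurfaceCov

/-! ### Liftings of diffeomorphisms -/

section LiftDiffeo

variable {S S' : ClosedSurface}

/-- The lift to `S × ℝ → S' × ℝ` of a map `Φ : S × S¹ → S' × S¹` whose second component is
`(x, ζ) ↦ ζ ^ ε * Π (θ (x, ζ))`. -/
noncomputable def liftMap (Φ : S × Circle → S' × Circle) (ε : ℤ) (θ : S × Circle → ℝ)
    (p : S × ℝ) : S' × ℝ :=
  ((Φ (surfaceCov S p)).1, ε * p.2 + θ (surfaceCov S p))

variable {Φ : S × Circle → S' × Circle} {ε : ℤ} {θ : S × Circle → ℝ}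

theorem surfaceCov_liftMap (hθ : ∀ p, (Φ p).2 = p.2 ^ ε * cov (θ p)) (p : S × ℝ) :
    surfaceCov S' (liftMap Φ ε θ p) = Φ (surfaceCov S p) := by
  refine Prod.ext rfl ?_
  simp only [liftMap, surfaceCov, hθ, cov_add, cov_intCast_mul]

theorem liftMap_add_int (x : S) (t : ℝ) (m : ℤ) :
    liftMap Φ ε θ (x, t + m) =
      ((liftMap Φ ε θ (x, t)).1, (liftMap Φ ε θ (x, t)).2 + (ε * m : ℤ)) := by
  simp only [liftMap, surfaceCov_add_int]
  refine Prod.ext rfl ?_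
  push_cast
  ring

theorem contMDiff_liftMap (hΦ : ContMDiff ((𝓡 2).prod (𝓡 1)) ((𝓡 2).prod (𝓡 1)) ∞ Φ)
    (hθc : Continuous θ) (hθ : ∀ p, (Φ p).2 = p.2 ^ ε * cov (θ p)) :
    ContMDiff ((𝓡 2).prod 𝓘(ℝ, ℝ)) ((𝓡 2).prod 𝓘(ℝ, ℝ)) ∞ (liftMap Φ ε θ) := by
  have hc := (contMDiff_surfaceCov S).continuous
  refine contMDiff_of_surfaceCov_comp (Continuous.prodMk ?_ ?_) ?_
  · exact continuous_fst.comp (hΦ.continuous.comp hc)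
  · exact (continuous_const.mul continuous_snd).add (hθc.comp hc)
  · simp only [surfaceCov_liftMap hθ]
    exact hΦ.comp (contMDiff_surfaceCov S)

/-- The inverse of `Φ` has the logarithm `-ε * θ ∘ Φ⁻¹`. -/
theorem snd_rightInverse {Ψ : S' × Circle → S × Circle} (hε : ε * ε = 1)
    (hθ : ∀ p, (Φ p).2 = p.2 ^ ε * cov (θ p)) (hΨ : ∀ p, Φ (Ψ p) = p) (q : S' × Circle) :
    (Ψ q).2 = q.2 ^ ε * cov (-ε * θ (Ψ q)) := by
  have h := hθ (Ψ q)
  rw [hΨ] at h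
  rw [h, mul_zpow, ← zpow_mul, hε, zpow_one, ← cov_intCast_mul, mul_assoc, ← cov_add]
  simp [cov_zero]

theorem liftMap_rightInverse {Ψ : S' × Circle → S × Circle} (hε : ε * ε = 1)
    (hθ : ∀ p, (Φ p).2 = p.2 ^ ε * cov (θ p)) (hΨ : ∀ p, Φ (Ψ p) = p) (p : S' × ℝ) :
    liftMap Φ ε θ (liftMap Ψ ε (fun q => -ε * θ (Ψ q)) p) = p := by
  have h₁ : surfaceCov S (liftMap Ψ ε (fun q => -ε * θ (Ψ q)) p) = Ψ (surfaceCov S' p) :=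
    surfaceCov_liftMap (snd_rightInverse hε hθ hΨ) p
  have hε' : (ε : ℝ) * ε = 1 := by exact_mod_cast hε
  refine Prod.ext ?_ ?_
  · rw [liftMap, h₁, hΨ]
    rfl
  · rw [liftMap, h₁]
    simp only [liftMap]
    linear_combination (p.2 - θ (Ψ (surfaceCov S' p))) * hε'

/-- The covering has the same differential at all points of an orbit of the deck transformations. -/
theorem mfderiv_surfaceCov_add_int (y : S) (u : ℝ) (m : ℤ) (v : EuclideanSpace ℝ (Fin 2) × ℝ) :
    mfderiv ((𝓡 2).prod 𝓘(ℝ, ℝ)) ((𝓡 2).prod (𝓡 1)) (surfaceCov S) (y, u + m) v =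
      mfderiv ((𝓡 2).prod 𝓘(ℝ, ℝ)) ((𝓡 2).prod (𝓡 1)) (surfaceCov S) (y, u) v := by
  have hd : MDifferentiableAt 𝓘(ℝ, ℝ) 𝓘(ℝ, ℝ) (fun t : ℝ => t + m) u :=
    (differentiableAt_id.add_const _).mdifferentiableAt
  have hτ : mfderiv ((𝓡 2).prod 𝓘(ℝ, ℝ)) ((𝓡 2).prod 𝓘(ℝ, ℝ))
      (Prod.map (id : S → S) (fun t : ℝ => t + m)) (y, u) v = v := by
    rw [mfderiv_prodMap mdifferentiableAt_id hd, mfderiv_id, mfderiv_eq_fderiv, fderiv_add_const]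
    simp only [fderiv_fun_id]
    rfl
  have hc := mfderiv_comp (I := (𝓡 2).prod 𝓘(ℝ, ℝ)) (I' := (𝓡 2).prod 𝓘(ℝ, ℝ))
    (I'' := (𝓡 2).prod (𝓡 1)) (y, u) (mdifferentiableAt_surfaceCov (y, u + (m : ℝ)))
    (mdifferentiableAt_id.prodMap hd)
  have hτ' : surfaceCov S ∘ Prod.map id (fun t : ℝ => t + m) = surfaceCov S :=
    funext fun p => surfaceCov_add_int S p.1 p.2 m
  rw [hτ'] at hc
  have hc' := DFunLike.congr_fun hc v
  refine Eq.trans ?_ hc'.symm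
  exact congrArg (mfderiv ((𝓡 2).prod 𝓘(ℝ, ℝ)) ((𝓡 2).prod (𝓡 1)) (surfaceCov S)
    (y, u + (m : ℝ))) hτ.symm

variable (Φ : (S × Circle) ≃ₘ⟮(𝓡 2).prod (𝓡 1), (𝓡 2).prod (𝓡 1)⟯ (S' × Circle))

/-- The lift of a diffeomorphism `S × S¹ → S' × S¹` to a diffeomorphism `S × ℝ → S' × ℝ`. -/
noncomputable def liftDiffeo (hε : ε * ε = 1) (hθc : Continuous θ)
    (hθ : ∀ p, (Φ p).2 = p.2 ^ ε * cov (θ p)) :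
    (S × ℝ) ≃ₘ⟮(𝓡 2).prod 𝓘(ℝ, ℝ), (𝓡 2).prod 𝓘(ℝ, ℝ)⟯ (S' × ℝ) where
  toFun := liftMap Φ ε θ
  invFun := liftMap Φ.symm ε (fun q => -ε * θ (Φ.symm q))
  left_inv p := by
    have h := liftMap_rightInverse hε (snd_rightInverse hε hθ Φ.apply_symm_apply)
      Φ.symm_apply_apply p
    have hε' : (ε : ℝ) * ε = 1 := by exact_mod_cast hε
    have h₁ : (fun q => -(ε : ℝ) * (-ε * θ (Φ.symm (Φ q)))) = θ := by
      ext q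
      rw [Φ.symm_apply_apply]
      linear_combination θ q * hε'
    rwa [h₁] at h
  right_inv p := liftMap_rightInverse hε hθ Φ.apply_symm_apply p
  contMDiff_toFun := contMDiff_liftMap Φ.contMDiff hθc hθ
  contMDiff_invFun := contMDiff_liftMap Φ.symm.contMDiff
    (continuous_const.mul (hθc.comp Φ.symm.continuous))
    (snd_rightInverse hε hθ Φ.apply_symm_apply)

theorem preservesOrientationReal_liftDiffeo (hε : ε * ε = 1) (hθc : Continuous θ)
    (hθ : ∀ p, (Φ p).2 = p.2 ^ ε * cov (θ p)) (h : PreservesOrientationCircle Φ) :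
    PreservesOrientationReal (liftDiffeo Φ hε hθc hθ) := by
  rintro ⟨x, t⟩
  obtain ⟨t', A, ht', hA, hdet⟩ := h x t
  set L := liftDiffeo Φ hε hθc hθ 
  have hcov : ∀ p, surfaceCov S' (L p) = Φ (surfaceCov S p) := surfaceCov_liftMap hθ
  -- The point `t'` over which `A` is given differs from the height of `L (x, t)` by a deck
  -- transformation, which does not change the differential.
  obtain ⟨m, hm⟩ : ∃ m : ℤ, t' = (L (x, t)).2 + m :=
    cov_eq_cov.1 (ht'.trans (congrArg Prod.snd (hcov (x, t))).symm)
  have hc := mfderiv_comp (x, t) (mdifferentiableAt_surfaceCov (L (x, t)))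
    (L.contMDiff.mdifferentiableAt (by simp))
  rw [show surfaceCov S' ∘ L = fun p => Φ (surfaceCov S p) from funext hcov] at hc
  have hAL : A = mfderiv ((𝓡 2).prod 𝓘(ℝ, ℝ)) ((𝓡 2).prod 𝓘(ℝ, ℝ)) L (x, t) := by
    refine ContinuousLinearMap.ext fun v => ?_
    refine mfderiv_surfaceCov_injective (L (x, t)) ?_
    refine Eq.trans ?_ ((hA v).symm.trans (DFunLike.congr_fun hc v))
    rw [hm]
    exact (mfderiv_surfaceCov_add_int _ _ m (A v)).symm
  rw [← hAL]
  exact hdet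

/-- Up to a bounded error `θ`, a lift with `ε = 1` preserves heights; so it preserves the ends. -/
theorem tendsto_snd_liftMap {Φ : S × Circle → S' × Circle} (hθc : Continuous θ) :
    Tendsto (fun p => (liftMap Φ 1 θ p).2) (comap Prod.snd atTop) atTop ∧
    Tendsto (fun p => (liftMap Φ 1 θ p).2) (comap Prod.snd atBot) atBot := by
  obtain ⟨C, hC⟩ := (isCompact_range hθc).isBounded.exists_norm_le
  have hC' : ∀ q, |θ q| ≤ C := fun q => hC _ ⟨q, rfl⟩
  constructor
  · refine tendsto_atTop_mono (f := fun p : S × ℝ => p.2 + -C) (fun p => ?_)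
      (tendsto_atTop_add_const_right _ _ tendsto_comap)
    simp only [liftMap, Int.cast_one, one_mul]
    linarith [(abs_le.1 (hC' (surfaceCov S p))).1]
  · have hb : Tendsto (fun p : S × ℝ => p.2 + C) (comap Prod.snd atBot) atBot :=
      tendsto_atBot_add_const_right _ _ tendsto_comap
    refine tendsto_atBot_mono (fun p => ?_) hb
    simp only [liftMap, Int.cast_one, one_mul]
    linarith [(abs_le.1 (hC' (surfaceCov S p))).2]

/-- An allowed diffeomorphism of `S × S¹` lifts to an allowed diffeomorphism of `S × ℝ`. -/
theorem exists_lift_of_allowedCircle {ambient : Bool} (h : AllowedCircle ambient S S' Φ) :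
    ∃ (ε : ℤ) (θ : S × Circle → ℝ) (hε : ε * ε = 1) (hθc : Continuous θ)
      (hθ : ∀ p, (Φ p).2 = p.2 ^ ε * cov (θ p)),
      AllowedReal ambient S S' (liftDiffeo Φ hε hθc hθ) := by
  cases ambient with
  | true =>
    obtain ⟨hq, ho⟩ := h
    obtain ⟨θ, hθ⟩ := exists_cov_mul_of_homotopic hq
    have hθ' : ∀ p, (Φ p).2 = p.2 ^ (1 : ℤ) * cov (θ p) := fun p => by
      rw [zpow_one]; exact hθ p
    exact ⟨1, θ, by norm_num, θ.continuous, hθ', fun _ =>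
      ⟨preservesOrientationReal_liftDiffeo Φ _ _ _ ho, tendsto_snd_liftMap θ.continuous⟩⟩
  | false =>
    rcases h with hq | hq
    · obtain ⟨θ, hθ⟩ := exists_cov_mul_of_homotopic hq
      exact ⟨1, θ, by norm_num, θ.continuous, fun p => by rw [zpow_one]; exact hθ p,
        fun h => absurd h (by simp)⟩
    · obtain ⟨θ, hθ⟩ := exists_cov_mul_of_homotopic hq
      exact ⟨-1, θ, by norm_num, θ.continuous, fun p => by rw [zpow_neg_one]; exact hθ p,
        fun h => absurd h (by simp)⟩

end LiftDiffeo

/-! ### Liftings of knots -/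

theorem continuous_curve (K : Knot) : Continuous K.curve := (K.isLink.smooth ()).continuous

theorem curve_injective (K : Knot) : Function.Injective K.curve := fun z w h => by
  have := K.isLink.embedding.injective (a₁ := ⟨(), z⟩) (a₂ := ⟨(), w⟩) h
  simpa using this

/-- The projection of `K` to `S¹` has a logarithm. -/
def HasLog (K : Knot) : Prop := ∃ g : Circle → ℝ, Continuous g ∧ ∀ z, cov (g z) = (K.curve z).2

theorem hasDegree_zero_iff {K : Knot} : HasDegree K 0 ↔ HasLog K := by
  constructor
  · rintro ⟨f, hf, hcov, hper⟩
    have hper' : Function.Periodic f 1 := fun t => by simpa using hper t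
    have hfac : ∀ t, f (turn (cov t)) = f t := fun t => by
      obtain ⟨m, hm⟩ := cov_eq_cov.1 (cov_turn (cov t))
      rw [hm]
      simpa using hper'.int_mul m t
    refine ⟨fun z => f (turn z), isQuotientMap_cov.continuous_iff.2 ?_, fun z => ?_⟩
    · exact hf.congr fun t => (hfac t).symm
    · rw [hcov, cov_turn]
  · rintro ⟨g, hg, hcov⟩
    refine ⟨fun t => g (cov t), hg.comp continuous_cov, fun t => hcov _, fun t => ?_⟩
    have h := cov_add_int t 1
    rw [Int.cast_one] at h
    simp [h]

theorem HasLog.exists_isLifting {K : Knot} (h : HasLog K) : ∃ k, IsLifting K k := by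
  obtain ⟨g, hg, hcov⟩ := h
  exact ⟨fun z => ((K.curve z).1, g z), (continuous_fst.comp (continuous_curve K)).prodMk hg,
    fun z => Prod.ext rfl (hcov z)⟩

section Lifting

variable {K : Knot} {k k' : Circle → K.surface × ℝ}

theorem IsLifting.exists_int (hk : IsLifting K k) (hk' : IsLifting K k') :
    ∃ m : ℤ, ∀ z, k z = ((k' z).1, (k' z).2 + m) := by
  have h : ∀ z, surfaceCov K.surface (k z) = surfaceCov K.surface (k' z) := fun z =>
    (hk.2 z).trans (hk'.2 z).symm
  obtain ⟨m, hm⟩ := exists_int_of_cov_comp_eq (continuous_snd.comp hk.1)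
    (continuous_snd.comp hk'.1) fun z => congrArg Prod.snd (h z)
  exact ⟨m, fun z => Prod.ext (surfaceCov_eq.1 (h z)).1 (hm z)⟩

theorem surfaceCov_liftings (hk : IsLifting K k) (s : ℤ) (z : Circle) :
    surfaceCov K.surface (liftings k s z) = K.curve z :=
  (surfaceCov_add_int _ _ _ s).trans (hk.2 z)

theorem continuous_liftings (hk : IsLifting K k) :
    Continuous fun p : Σ _ : ℤ, Circle => liftings k p.1 p.2 := by
  refine continuous_sigma fun s => ?_
  exact (continuous_fst.comp hk.1).prodMk ((continuous_snd.comp hk.1).add (continuous_const (y := (s : ℝ))))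

theorem liftings_injective (hk : IsLifting K k) :
    Function.Injective fun p : Σ _ : ℤ, Circle => liftings k p.1 p.2 := by
  rintro ⟨s, z⟩ ⟨t, w⟩ (h : liftings k s z = liftings k t w)
  have hzw : z = w := curve_injective K <| by
    rw [← surfaceCov_liftings hk s z, h, surfaceCov_liftings hk]
  subst hzw
  have hst : (k z).2 + (s : ℝ) = (k z).2 + t := congrArg Prod.snd h
  have : s = t := by exact_mod_cast add_left_cancel hst
  rw [this]

/-- The translates of a lifting form a closed subset of `S × ℝ`: only finitely many of them meet
a given compact set. -/
theorem isClosedEmbedding_liftings (hk : IsLifting K k) :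
    Topology.IsClosedEmbedding fun p : Σ _ : ℤ, Circle => liftings k p.1 p.2 := by
  refine .of_continuous_injective_isClosedMap (continuous_liftings hk) (liftings_injective hk)
    (IsProperMap.isClosedMap ?_)
  refine isProperMap_iff_isCompact_preimage.2 ⟨continuous_liftings hk, fun A hA => ?_⟩
  obtain ⟨C, hC⟩ := (hA.image continuous_snd).isBounded.exists_norm_le
  obtain ⟨B, hB⟩ := (isCompact_range (continuous_snd.comp hk.1)).isBounded.exists_norm_le
  obtain ⟨N, hN⟩ := exists_nat_ge (C + B)
  have hfin : (Icc (-N : ℤ) N).Finite := finite_Icc _ _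
  refine (hfin.isCompact_biUnion (f := fun s => Sigma.mk s '' (univ : Set Circle))
    fun s _ => isCompact_univ.image continuous_sigmaMk).of_isClosed_subset
    (hA.isClosed.preimage (continuous_liftings hk)) ?_
  rintro ⟨s, z⟩ hz
  refine mem_biUnion (x := s) ?_ ⟨z, mem_univ _, rfl⟩
  have h₁ : |(k z).2 + s| ≤ C := hC _ ⟨_, hz, rfl⟩
  have h₂ : |(k z).2| ≤ B := hB _ ⟨z, rfl⟩
  rw [abs_le] at h₁ h₂
  have h₃ : (-N : ℝ) ≤ s := by linarith
  have h₄ : (s : ℝ) ≤ N := by linarith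
  exact ⟨by exact_mod_cast h₃, by exact_mod_cast h₄⟩

theorem isLink_liftings (hk : IsLifting K k) : IsLink 𝓘(ℝ, ℝ) ℝ K.surface (liftings k) := by
  have hsmooth : ∀ s, ContMDiff (𝓡 1) ((𝓡 2).prod 𝓘(ℝ, ℝ)) ∞ (liftings k s) := fun s => by
    refine contMDiff_of_surfaceCov_comp
      ((continuous_liftings hk).comp (continuous_sigmaMk (i := s))) ?_
    simp only [surfaceCov_liftings hk]
    exact K.isLink.smooth ()
  refine ⟨hsmooth, fun s z => ?_, (isClosedEmbedding_liftings hk).isEmbedding⟩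
  have hc := mfderiv_comp z (mdifferentiableAt_surfaceCov (liftings k s z))
    ((hsmooth s).mdifferentiableAt (by simp))
  rw [show surfaceCov K.surface ∘ liftings k s = K.toFun () from
    funext (surfaceCov_liftings hk s)] at hc
  have hinj := K.isLink.immersive () z
  rw [hc] at hinj
  exact Function.Injective.of_comp hinj

/-- The link in `S × ℝ` formed by all liftings of a knot in `S × S¹`. -/
abbrev liftLink (K : Knot) (k : Circle → K.surface × ℝ) (hk : IsLifting K k) :
    Link 𝓘(ℝ, ℝ) ℝ ℤ :=
  ⟨K.surface, K.connected, liftings k, isLink_liftings hk⟩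

end Lifting

/-! ### Lifting equivalences -/

theorem allowedReal_refl (ambient : Bool) (S : ClosedSurface) :
    AllowedReal ambient S S (Diffeomorph.refl ((𝓡 2).prod 𝓘(ℝ, ℝ)) (S × ℝ) ∞) := by
  refine fun _ => ⟨fun p => ?_, tendsto_comap, tendsto_comap⟩
  have h : mfderiv ((𝓡 2).prod 𝓘(ℝ, ℝ)) ((𝓡 2).prod 𝓘(ℝ, ℝ))
      (Diffeomorph.refl ((𝓡 2).prod 𝓘(ℝ, ℝ)) (S × ℝ) ∞) p = ContinuousLinearMap.id ℝ _ :=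
    mfderiv_id
  rw [h]
  refine lt_of_lt_of_eq one_pos ?_
  exact (LinearMap.det_id (A := ℝ) (M := EuclideanSpace ℝ (Fin 2) × ℝ)).symm

theorem preservesCircleOrientation_refl :
    PreservesCircleOrientation (Diffeomorph.refl (𝓡 1) Circle ∞) :=
  ⟨id, continuous_id, strictMono_id, fun _ => rfl⟩

/-- Two liftings of the same knot give the same link up to the numbering of the components. -/
theorem equivalent_liftLink_self (ambient oriented : Bool) {K : Knot}
    {k k' : Circle → K.surface × ℝ} (hk : IsLifting K k) (hk' : IsLifting K k') :
    EquivalentInLineBundle ambient oriented (liftLink K k hk) (liftLink K k' hk') := by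
  obtain ⟨m, hm⟩ := hk.exists_int hk'
  refine .rel _ _ (.inl ⟨Diffeomorph.refl _ _ _, allowedReal_refl ambient K.surface,
    Equiv.addLeft m, fun _ => Diffeomorph.refl _ _ _,
    fun _ _ => preservesCircleOrientation_refl, fun s z => ?_⟩)
  change liftings k s z = liftings k' (m + s) z
  simp only [liftings, hm z]
  push_cast
  rw [add_assoc]

section DiffeoStep

variable {K K' : Knot}
  {Φ : (K.surface × Circle) ≃ₘ⟮(𝓡 2).prod (𝓡 1), (𝓡 2).prod (𝓡 1)⟯ (K'.surface × Circle)}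
  {ε : ℤ} {θ : K.surface × Circle → ℝ} {r : Circle ≃ₘ⟮𝓡 1, 𝓡 1⟯ Circle}

theorem hasLog_iff_of_diffeo (hε : ε * ε = 1) (hθc : Continuous θ)
    (hθ : ∀ p, (Φ p).2 = p.2 ^ ε * cov (θ p)) (hr : ∀ z, Φ (K.curve z) = K'.curve (r z)) :
    HasLog K ↔ HasLog K' := by
  have hθK : Continuous fun z => θ (K.curve z) := hθc.comp (continuous_curve K)
  constructor
  · rintro ⟨g, hg, hcov⟩
    refine ⟨fun z => ε * g (r.symm z) + θ (K.curve (r.symm z)),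
      (continuous_const.mul (hg.comp r.symm.continuous)).add (hθK.comp r.symm.continuous),
      fun z => ?_⟩
    have h := hθ (K.curve (r.symm z))
    rw [hr, r.apply_symm_apply] at h
    rw [h, cov_add, cov_intCast_mul, hcov]
  · rintro ⟨g, hg, hcov⟩
    refine ⟨fun z => ε * (g (r z) + -θ (K.curve z)),
      continuous_const.mul ((hg.comp r.continuous).add hθK.neg), fun z => ?_⟩
    have h := hθ (K.curve z)
    rw [hr, ← hcov] at h
    rw [cov_intCast_mul, cov_add, cov_neg, h, mul_inv_cancel_right, ← zpow_mul, hε, zpow_one]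

theorem equivalent_liftLink_of_diffeo {ambient oriented : Bool} (hε : ε * ε = 1)
    (hθc : Continuous θ) (hθ : ∀ p, (Φ p).2 = p.2 ^ ε * cov (θ p))
    (hall : AllowedReal ambient K.surface K'.surface (liftDiffeo Φ hε hθc hθ))
    (hor : oriented = true → PreservesCircleOrientation r)
    (hr : ∀ z, Φ (K.curve z) = K'.curve (r z))
    {k : Circle → K.surface × ℝ} {k' : Circle → K'.surface × ℝ}
    (hk : IsLifting K k) (hk' : IsLifting K' k') :
    EquivalentInLineBundle ambient oriented (liftLink K k hk) (liftLink K' k' hk') := by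
  -- The image of `k` under the lift of `Φ` is a lifting of `K'`, hence a translate of `k'`.
  have hk'' : IsLifting K' fun z => liftDiffeo Φ hε hθc hθ (k (r.symm z)) := by
    refine ⟨(liftDiffeo Φ hε hθc hθ).continuous.comp (hk.1.comp r.symm.continuous), fun z => ?_⟩
    refine (surfaceCov_liftMap hθ _).trans ?_
    rw [hk.2, hr, r.apply_symm_apply]
  obtain ⟨m, hm⟩ := hk''.exists_int hk'
  have hm' : ∀ z, liftMap Φ ε θ (k z) = ((k' (r z)).1, (k' (r z)).2 + m) := fun z => by
    have h := hm (r z)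
    simp only [r.symm_apply_apply] at h
    exact h
  let σ : Equiv.Perm ℤ :=
    { toFun := fun s => m + ε * s
      invFun := fun s => ε * (s - m)
      left_inv := fun s => by linear_combination s * hε
      right_inv := fun s => by linear_combination (s - m) * hε }
  refine .rel _ _ (.inl ⟨liftDiffeo Φ hε hθc hθ, hall, σ, fun _ => r, fun h _ => hor h,
    fun s z => ?_⟩)
  change liftMap Φ ε θ (liftings k s z) = liftings k' (m + ε * s) (r z)
  refine (liftMap_add_int (k z).1 (k z).2 s).trans ?_
  simp only [Prod.mk.eta, hm', liftings]
  push_cast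
  rw [add_assoc]

end DiffeoStep

section DestabilizationStep

variable {ambient : Bool} {K K' : Knot}

theorem hasLog_iff_of_destabilizationStep (h : DestabilizationStep ambient K K') :
    HasLog K ↔ HasLog K' := by
  obtain ⟨_, _, _, hL⟩ := h
  have h₂ : ∀ z, (K'.curve z).2 = (K.curve z).2 := fun z => (hL () z).2
  simp only [HasLog, h₂]

theorem equivalent_liftLink_of_destabilizationStep (oriented : Bool)
    (h : DestabilizationStep ambient K K')
    {k : Circle → K.surface × ℝ} {k' : Circle → K'.surface × ℝ}
    (hk : IsLifting K k) (hk' : IsLifting K' k') :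
    EquivalentInLineBundle ambient oriented (liftLink K k hk) (liftLink K' k' hk') := by
  obtain ⟨D, hD, hC, hL⟩ := h
  have h₁ : ∀ z, (k z).1 = (K.curve z).1 := fun z => congrArg Prod.fst (hk.2 z)
  -- A destabilization does not change heights, so `K'` has a lifting at the heights of `k`.
  have hk'' : IsLifting K' fun z => ((K'.curve z).1, (k z).2) :=
    ⟨(continuous_fst.comp (continuous_curve K')).prodMk (continuous_snd.comp hk.1),
      fun z => Prod.ext rfl ((congrArg Prod.snd (hk.2 z)).trans (hL () z).2.symm)⟩
  refine .trans _ (liftLink K' _ hk'') _ (.rel _ _ (.inr ⟨D, hD, fun s z => ?_, fun s z => ?_⟩))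
    (equivalent_liftLink_self ambient oriented hk'' hk')
  · change (k z).1 ∉ D.circle
    rw [h₁]
    exact hC () z
  · refine ⟨?_, rfl⟩
    change D.component (K'.curve z).1 = D.keep (k z).1
    rw [h₁]
    exact (hL () z).1

end DestabilizationStep

/-- Equivalent knots have liftings at the same time, and these form equivalent links. -/
theorem equivalent_liftLink {ambient oriented : Bool} {K K' : Knot}
    (h : EquivalentInCircleBundle ambient oriented K K') :
    (HasLog K ↔ HasLog K') ∧ ∀ k k' (hk : IsLifting K k) (hk' : IsLifting K' k'),
      EquivalentInLineBundle ambient oriented (liftLink K k hk) (liftLink K' k' hk') := by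
  induction h with
  | rel K K' h =>
    rcases h with ⟨Φ, hΦ, σ, r, hor, hr⟩ | h
    · obtain ⟨ε, θ, hε, hθc, hθ, hall⟩ := exists_lift_of_allowedCircle Φ hΦ
      have hr' : ∀ z, Φ (Knot.curve K z) = Knot.curve K' (r () z) := hr ()
      exact ⟨hasLog_iff_of_diffeo hε hθc hθ hr', fun k k' hk hk' =>
        equivalent_liftLink_of_diffeo hε hθc hθ hall (fun h => hor h ()) hr' hk hk'⟩
    · exact ⟨hasLog_iff_of_destabilizationStep h, fun k k' hk hk' =>
        equivalent_liftLink_of_destabilizationStep oriented h hk hk'⟩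
  | refl K => exact ⟨Iff.rfl, fun k k' hk hk' => equivalent_liftLink_self _ _ hk hk'⟩
  | symm K K' _ ih => exact ⟨ih.1.symm, fun k k' hk hk' => .symm _ _ (ih.2 k' k hk' hk)⟩
  | trans K K' K'' _ _ ih₁ ih₂ =>
    refine ⟨ih₁.1.trans ih₂.1, fun k k'' hk hk'' => ?_⟩
    -- The knot in the middle has a lifting because `K` has one.
    have hlog : HasLog K := ⟨fun z => (k z).2, continuous_snd.comp hk.1,
      fun z => congrArg Prod.snd (hk.2 z)⟩
    obtain ⟨k', hk'⟩ := (ih₁.1.1 hlog).exists_isLifting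
    exact .trans _ _ _ (ih₁.2 k k' hk hk') (ih₂.2 k' k'' hk' hk'')

/-! ### Crossings -/

theorem isLayerCrossing_liftings_iff {K : Knot} {k : Circle → K.surface × ℝ}
    (hk : IsLifting K k) (n s t : ℤ) (z w : Circle) :
    IsLayerCrossing (liftings k) n s z t w ↔
      IsCrossing K z w ∧ s + arcLabel k z = n ∧ t + arcLabel k w = n := by
  have h₁ : ∀ z, (K.curve z).1 = (k z).1 := fun z => (congrArg Prod.fst (hk.2 z)).symm
  have h₂ : ∀ z, cutHeight (K.curve z).2 = (k z).2 - ⌊(k z).2⌋ := fun z => by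
    rw [← hk.2 z]
    exact cutHeight_cov _
  have h₃ : ∀ (s : ℤ) z, (k z).2 + s ∈ Ico (n : ℝ) (n + 1) ↔ s + ⌊(k z).2⌋ = n := fun s z => by
    rw [add_comm s, ← Int.floor_add_intCast, Int.floor_eq_iff, mem_Ico]
  simp only [IsLayerCrossing, IsCrossing, liftings, arcLabel, h₁, h₂, h₃, and_assoc]
  refine and_congr_right fun _ => and_congr_left fun h => ?_
  have hs : (s : ℝ) + ⌊(k z).2⌋ = n := by exact_mod_cast h.1
  have ht : (t : ℝ) + ⌊(k w).2⌋ = n := by exact_mod_cast h.2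
  constructor <;> intro <;> linarith

end SurfaceLink

theorem mainTheorem3 (ambient oriented : Bool) (K K' : Knot)
    (hdeg : HasDegree K 0)
    (hequiv : EquivalentInCircleBundle ambient oriented K K') :
    HasDegree K' 0 ∧
    (∃ k, IsLifting K k) ∧ (∃ k', IsLifting K' k') ∧
    (∀ k k', IsLifting K k → IsLifting K' k' →
      ∃ (h : IsLink 𝓘(ℝ, ℝ) ℝ K.surface (liftings k))
        (h' : IsLink 𝓘(ℝ, ℝ) ℝ K'.surface (liftings k')),
        EquivalentInLineBundle ambient oriented
          ⟨K.surface, K.connected, liftings k, h⟩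
          ⟨K'.surface, K'.connected, liftings k', h'⟩) ∧
    (∀ k, IsLifting K k →
      (∀ n s t z w, IsLayerCrossing (liftings k) n s z t w ↔
        IsCrossing K z w ∧ s + arcLabel k z = n ∧ t + arcLabel k w = n) ∧
      (∀ z w b a, IsCrossing K z w → arcLabel k z = b → arcLabel k w = a →
        crossingLabel k z w = b - a ∧
        IsLayerCrossing (liftings k) (a + b) a z b w)) := by
  obtain ⟨hlog, hlink⟩ := equivalent_liftLink hequiv
  have hK : HasLog K := hasDegree_zero_iff.1 hdeg
  have hK' : HasLog K' := hlog.1 hK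
  refine ⟨hasDegree_zero_iff.2 hK', hK.exists_isLifting, hK'.exists_isLifting,
    fun k k' hk hk' => ⟨isLink_liftings hk, isLink_liftings hk', hlink k k' hk hk'⟩,
    fun k hk => ⟨fun n s t z w => isLayerCrossing_liftings_iff hk n s t z w, ?_⟩⟩
  rintro z w b a hc rfl rfl
  exact ⟨rfl, (isLayerCrossing_liftings_iff hk _ _ _ _ _).2 ⟨hc, rfl, add_comm _ _⟩⟩
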